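/- A virtual link diagram $D$ is an oriented $4$-valent graph embedded in the plane (crossing-free closed curves are also allowed), whose strands run straight through the vertices, and each of whose vertices is marked as a positive, negative or virtual crossing; positive and negative crossings are called classical. Draw every classical crossing $c_i$ ($1\le i\le n$) with both strands running downwards, and call its half-edges $i_l^-$ (upper left, incoming), $i_r^-$ (upper right, incoming), $i_l^+$ (lower left, outgoing), $i_r^+$ (lower right, outgoing). Let $M=\operatorname{diag}(M_1,\dots,M_n)$ be the $2n\times 2n$ block matrix with $M_i=M_+$ if $c_i$ is positive and $M_i=M_-$ if $c_i$ is negative, where $$M_+=\begin{pmatrix}1-x&-y\\-xy^{-1}&0\end{pmatrix},\qquad M_-=\begin{pmatrix}0&-x^{-1}y\\-y^{-1}&1-x^{-1}\end{pmatrix}.$$ Let $P$ be the $2n\times 2n$ permutation matrix, with rows and columns enumerated by $(1,l),(1,r),\dots,(n,l),(n,r)$, whose entry in row $(i,a)$ and column $(j,b)$ is $1$ if $i_a^+$ and $j_b^-$ belong to the same edge of the graph obtained from $D$ by ignoring the virtual crossings, and $0$ otherwise. Let $w(D)$ be the number of positive minus the number of negative crossings of $D$. Define $Z_D(x,y)=(-1)^{w(D)}\det(M-P)\in\mathbb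 Z[x^{\pm1},y^{\pm1}]$ if $n\ge 1$, and $Z_D(x,y)=0$ if $n=0$. Define $\widetilde Z_D(x,y)=x^{-N}Z_D(x,y)$, where $N$ is the lowest exponent of $x$ in $Z_D$, if $Z_D\neq 0$, and $\widetilde Z_D=0$ if $Z_D=0$. **Theorem.** (a) If $D$ is a virtual link diagram without virtual crossings (a classical diagram), then $Z_D(x,y)=\widetilde Z_D(x,y)=0$. (b) Let $D_1,D_2$ be virtual link diagrams that either both have at least one classical crossing or both have none, and let $D_1\sqcup D_2$ be their disconnected sum (disjoint union). Then $$Z_{D_1\sqcup D_2}(x,y)=Z_{D_1}(x,y)\,Z_{D_2}(x,y),\qquad \widetilde Z_{D_1\sqcup D_2}(x,y)=\widetilde Z_{D_1}(x,y)\,\widetilde Z_{D_2}(x,y).$$ -/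

import Mathlib

open scoped LaurentPolynomial

namespace VirtualLink

/-- The two sides of a crossing, seen on the page with the crossing drawn as below. -/
inductive Side
  | l
  | r
  deriving DecidableEq

instance : Fintype Side := ⟨{.l, .r}, fun a => by cases a <;> simp⟩

/-- The other side. -/
def Side.other : Side → Side
  | .l => .r
  | .r => .l

/-- The three crossing types of an oriented virtual link diagram. -/
inductive CrossingType
  | positive
  | negative
  | virtual
  deriving DecidableEq

/-- The four half-edges at every vertex `v`, drawn with both strands running down the page:

      (v,l)⁻   (v,r)⁻
           \   /
             v
           /   \
      (v,l)⁺   (v,r)⁺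

`into (v, a)` is the incoming half-edge `(v,a)⁻` and `out (v, a)` is the outgoing half-edge
`(v,a)⁺`.  One strand runs from `(v,l)⁻` straight to `(v,r)⁺`, the other one from `(v,r)⁻`
straight to `(v,l)⁺`.  Which of them is the over-strand is determined by the sign of the
crossing. -/
inductive HalfEdge (V : Type)
  | into (p : V × Side)
  | out (p : V × Side)

/-- The half-edge that follows in the counterclockwise order around the vertex. -/
def HalfEdge.rotate {V : Type} : HalfEdge V → HalfEdge V
  | .into (v, .l) => .out (v, .l)
  | .out (v, .l) => .out (v, .r)
  | .out (v, .r) => .into (v, .r)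
  | .into (v, .r) => .into (v, .l)

/-- The other half of the edge that contains a given half-edge, where the edge that leaves by the
outgoing half-edge `p` arrives by the incoming half-edge `next p`. -/
def HalfEdge.opposite {V : Type} (next : Equiv.Perm (V × Side)) : HalfEdge V → HalfEdge V
  | .into p => .out (next.symm p)
  | .out p => .into (next p)

/-- The connected components of the 4-valent graph with the edges `p⁺ — (next p)⁻`. -/
def Component {V : Type} (next : Equiv.Perm (V × Side)) : Type :=
  Quot fun v w : V => ∃ a b : Side, next (v, a) = (w, b)

/-- The faces of the 4-valent graph with the given rotation system: the orbits of the
face-tracing map, which crosses an edge and then turns to the next half-edge. -/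
def Face {V : Type} (next : Equiv.Perm (V × Side)) : Type :=
  Quot fun d e : HalfEdge V => (HalfEdge.opposite next d).rotate = e

/-- A virtual link diagram, that is, an oriented 4-valent plane graph, with oriented edges that
go straight through the vertices, and a crossing type at each vertex.  The plane graph is given as
a combinatorial map (up to isotopy, and up to the mutual position of its connected components): the
vertices, the edges, and the rotation system (see `HalfEdge.rotate`), subject to planarity. -/
structure VirtualLinkDiagram where
  /-- The crossings, classical and virtual ones. -/
  V : Type
  [fintypeV : Fintype V]
  /-- The type of each crossing. -/
  kind : V → CrossingType
  /-- The edges: the edge that leaves by `(v,a)⁺` arrives by `(next (v,a))⁻`. -/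
  next : Equiv.Perm (V × Side)
  /-- Planarity, i.e. the sum of the Euler characteristics `#V - 2 #V + #Face` over all
  connected components is two times the number of connected components. -/
  planar : Nat.card (Face next) = Fintype.card V + 2 * Nat.card (Component next)
  /-- The number of simple closed curves of the diagram that pass through no crossing at all. -/
  circles : ℕ

attribute [instance] VirtualLinkDiagram.fintypeV

/-! ### Disconnected sums -/

/-- Half-edge names of a disjoint union of vertex sets. -/
def sumSideEquiv (V W : Type) : (V × Side) ⊕ (W × Side) ≃ (V ⊕ W) × Side :=
  (Equiv.sumProdDistrib V W Side).symm

/-- The edges of the disjoint union of two graphs. -/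
def sumNext {V W : Type} (f : Equiv.Perm (V × Side)) (g : Equiv.Perm (W × Side)) :
    Equiv.Perm ((V ⊕ W) × Side) :=
  (sumSideEquiv V W).permCongr (Equiv.Perm.sumCongr f g)

theorem sumNext_inl {V W : Type} (f : Equiv.Perm (V × Side)) (g : Equiv.Perm (W × Side))
    (v : V) (a : Side) :
    sumNext f g (Sum.inl v, a) = (Sum.inl (f (v, a)).1, (f (v, a)).2) := rfl

theorem sumNext_inr {V W : Type} (f : Equiv.Perm (V × Side)) (g : Equiv.Perm (W × Side))
    (w : W) (a : Side) :
    sumNext f g (Sum.inr w, a) = (Sum.inr (g (w, a)).1, (g (w, a)).2) := rfl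

theorem sumNext_symm_inl {V W : Type} (f : Equiv.Perm (V × Side)) (g : Equiv.Perm (W × Side))
    (v : V) (a : Side) :
    (sumNext f g).symm (Sum.inl v, a) = (Sum.inl (f.symm (v, a)).1, (f.symm (v, a)).2) := rfl

theorem sumNext_symm_inr {V W : Type} (f : Equiv.Perm (V × Side)) (g : Equiv.Perm (W × Side))
    (w : W) (a : Side) :
    (sumNext f g).symm (Sum.inr w, a) = (Sum.inr (g.symm (w, a)).1, (g.symm (w, a)).2) := rfl

/-- A quotient of a disjoint union by a relation that relates no element of one part to an
element of the other part. -/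
theorem card_quot_sum {α β γ : Type} [Finite α] [Finite β] (i : α → γ) (j : β → γ)
    (k : γ → α ⊕ β) (hki : ∀ a, k (i a) = Sum.inl a) (hkj : ∀ b, k (j b) = Sum.inr b)
    (hk : ∀ c, Sum.elim i j (k c) = c)
    (r : α → α → Prop) (s : β → β → Prop) (t : γ → γ → Prop)
    (hr : ∀ a a', r a a' → t (i a) (i a')) (hs : ∀ b b', s b b' → t (j b) (j b'))
    (ht : ∀ c c', t c c' → Sum.LiftRel r s (k c) (k c')) :
    Nat.card (Quot t) = Nat.card (Quot r) + Nat.card (Quot s) := by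
  rw [← Nat.card_sum]
  refine Nat.card_congr
    { toFun := Quot.lift (fun c => Sum.map (Quot.mk r) (Quot.mk s) (k c)) ?_
      invFun := Sum.elim (Quot.map i hr) (Quot.map j hs)
      left_inv := ?_
      right_inv := ?_ }
  · intro c c' h
    have h' := ht c c' h
    revert h'
    generalize k c = x
    generalize k c' = y
    intro h'
    cases h' with
    | inl h => exact congrArg Sum.inl (Quot.sound h)
    | inr h => exact congrArg Sum.inr (Quot.sound h)
  · rintro ⟨c⟩
    have h := hk c
    revert h
    show _ → Sum.elim (Quot.map i hr) (Quot.map j hs)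
      (Sum.map (Quot.mk r) (Quot.mk s) (k c)) = Quot.mk t c
    cases k c with
    | inl a => intro h; exact congrArg (Quot.mk t) h
    | inr b => intro h; exact congrArg (Quot.mk t) h
  · rintro (⟨⟨a⟩⟩ | ⟨⟨b⟩⟩)
    · show Sum.map (Quot.mk r) (Quot.mk s) (k (i a)) = _
      rw [hki]; rfl
    · show Sum.map (Quot.mk r) (Quot.mk s) (k (j b)) = _
      rw [hkj]; rfl

instance {V : Type} [Finite V] : Finite (HalfEdge V) :=
  Finite.of_surjective (fun x : (V × Side) ⊕ (V × Side) => Sum.elim HalfEdge.into HalfEdge.out x)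
    (by
      rintro (p | p)
      · exact ⟨Sum.inl p, rfl⟩
      · exact ⟨Sum.inr p, rfl⟩)

theorem card_component_sum {V W : Type} [Finite V] [Finite W] (f : Equiv.Perm (V × Side))
    (g : Equiv.Perm (W × Side)) :
    Nat.card (Component (sumNext f g)) = Nat.card (Component f) + Nat.card (Component g) := by
  refine card_quot_sum Sum.inl Sum.inr id (fun _ => rfl) (fun _ => rfl) ?_ _ _ _ ?_ ?_ ?_
  · rintro (v | w) <;> rfl
  · rintro v v' ⟨a, b, h⟩
    exact ⟨a, b, by rw [sumNext_inl, h]⟩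
  · rintro v v' ⟨a, b, h⟩
    exact ⟨a, b, by rw [sumNext_inr, h]⟩
  · rintro (v | v) c' ⟨a, b, h⟩
    · rw [sumNext_inl] at h
      obtain ⟨rfl, h2⟩ := Prod.mk.inj h
      exact Sum.LiftRel.inl ⟨a, b, Prod.ext rfl h2⟩
    · rw [sumNext_inr] at h
      obtain ⟨rfl, h2⟩ := Prod.mk.inj h
      exact Sum.LiftRel.inr ⟨a, b, Prod.ext rfl h2⟩

/-- The image of a half-edge under a map of vertices. -/
def HalfEdge.map {V W : Type} (i : V → W) : HalfEdge V → HalfEdge W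
  | .into (v, a) => .into (i v, a)
  | .out (v, a) => .out (i v, a)

/-- The half-edges of a disjoint union come from the two parts. -/
def HalfEdge.split {V W : Type} : HalfEdge (V ⊕ W) → HalfEdge V ⊕ HalfEdge W
  | .into (Sum.inl v, a) => Sum.inl (.into (v, a))
  | .into (Sum.inr w, a) => Sum.inr (.into (w, a))
  | .out (Sum.inl v, a) => Sum.inl (.out (v, a))
  | .out (Sum.inr w, a) => Sum.inr (.out (w, a))

theorem HalfEdge.rotate_map {V W : Type} (i : V → W) (d : HalfEdge V) :
    (d.map i).rotate = d.rotate.map i := by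
  rcases d with ⟨v, _ | _⟩ | ⟨v, _ | _⟩ <;> rfl

theorem HalfEdge.split_map_inl {V W : Type} (d : HalfEdge V) :
    (d.map (Sum.inl : V → V ⊕ W)).split = Sum.inl d := by
  rcases d with ⟨v, a⟩ | ⟨v, a⟩ <;> rfl

theorem HalfEdge.split_map_inr {V W : Type} (d : HalfEdge W) :
    (d.map (Sum.inr : W → V ⊕ W)).split = Sum.inr d := by
  rcases d with ⟨v, a⟩ | ⟨v, a⟩ <;> rfl

theorem HalfEdge.opposite_map_inl {V W : Type} (f : Equiv.Perm (V × Side))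
    (g : Equiv.Perm (W × Side)) (d : HalfEdge V) :
    (d.map Sum.inl).opposite (sumNext f g) = (d.opposite f).map Sum.inl := by
  rcases d with ⟨v, a⟩ | ⟨v, a⟩ <;> rfl

theorem HalfEdge.opposite_map_inr {V W : Type} (f : Equiv.Perm (V × Side))
    (g : Equiv.Perm (W × Side)) (d : HalfEdge W) :
    (d.map Sum.inr).opposite (sumNext f g) = (d.opposite g).map Sum.inr := by
  rcases d with ⟨v, a⟩ | ⟨v, a⟩ <;> rfl

theorem HalfEdge.elim_split {V W : Type} (c : HalfEdge (V ⊕ W)) :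
    Sum.elim (HalfEdge.map Sum.inl) (HalfEdge.map Sum.inr) c.split = c := by
  rcases c with ⟨v | v, a⟩ | ⟨v | v, a⟩ <;> rfl

theorem card_face_sum {V W : Type} [Finite V] [Finite W] (f : Equiv.Perm (V × Side))
    (g : Equiv.Perm (W × Side)) :
    Nat.card (Face (sumNext f g)) = Nat.card (Face f) + Nat.card (Face g) := by
  refine card_quot_sum (HalfEdge.map Sum.inl) (HalfEdge.map Sum.inr) HalfEdge.split
    HalfEdge.split_map_inl HalfEdge.split_map_inr HalfEdge.elim_split _ _ _ ?_ ?_ ?_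
  · rintro d e rfl
    rw [HalfEdge.opposite_map_inl, HalfEdge.rotate_map]
  · rintro d e rfl
    rw [HalfEdge.opposite_map_inr, HalfEdge.rotate_map]
  · rintro c c' rfl
    obtain ⟨x, rfl⟩ : ∃ x, Sum.elim (HalfEdge.map Sum.inl) (HalfEdge.map Sum.inr) x = c :=
      ⟨_, HalfEdge.elim_split c⟩
    rcases x with d | d
    · show Sum.LiftRel _ _ (d.map Sum.inl).split _
      rw [Sum.elim_inl, HalfEdge.opposite_map_inl, HalfEdge.rotate_map, HalfEdge.split_map_inl,
        HalfEdge.split_map_inl]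
      exact Sum.LiftRel.inl rfl
    · show Sum.LiftRel _ _ (d.map Sum.inr).split _
      rw [Sum.elim_inr, HalfEdge.opposite_map_inr, HalfEdge.rotate_map, HalfEdge.split_map_inr,
        HalfEdge.split_map_inr]
      exact Sum.LiftRel.inr rfl

namespace VirtualLinkDiagram

/-- The disconnected sum (disjoint union) of two diagrams. -/
def disjointSum (D₁ D₂ : VirtualLinkDiagram) : VirtualLinkDiagram where
  V := D₁.V ⊕ D₂.V
  kind := Sum.elim D₁.kind D₂.kind
  next := sumNext D₁.next D₂.next
  planar := by
    rw [card_face_sum, card_component_sum, Fintype.card_sum, D₁.planar, D₂.planar]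
    ring
  circles := D₁.circles + D₂.circles

/-! ### The Conway polynomial -/

variable (D : VirtualLinkDiagram)

/-- A classical diagram is one without virtual crossings. -/
def IsClassical : Prop := ∀ v : D.V, D.kind v ≠ .virtual

/-- The classical crossings. -/
def ClassicalCrossing : Type := {v : D.V // D.kind v ≠ .virtual}

noncomputable instance : Fintype D.ClassicalCrossing :=
  inferInstanceAs (Fintype {v : D.V // D.kind v ≠ .virtual})

noncomputable instance : DecidableEq D.ClassicalCrossing := Classical.decEq _

/-- `D.Reaches p q`: the curve that leaves by the outgoing half-edge `p⁺`, and goes straight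
through virtual crossings only, arrives by the incoming half-edge `q⁻`.  When `p` and `q` belong
to classical crossings, this says that `p⁺` and `q⁻` belong to the same edge of the graph
that is obtained from the diagram by ignoring the virtual crossings. -/
inductive Reaches (p : D.V × Side) : D.V × Side → Prop
  | edge : Reaches p (D.next p)
  | pass (v : D.V) (a : Side) :
      Reaches p (v, a) → D.kind v = .virtual → Reaches p (D.next (v, a.other))

/-- The ring `ℤ[x^{±1}, y^{±1}]`, as Laurent polynomials in `x` over the ring `ℤ[y^{±1}]`. -/
abbrev Laurent₂ : Type := ℤ[T;T⁻¹][T;T⁻¹]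

/-- The power `x ^ k`. -/
noncomputable def xPow (k : ℤ) : Laurent₂ := LaurentPolynomial.T k

/-- The power `y ^ k`. -/
noncomputable def yPow (k : ℤ) : Laurent₂ := LaurentPolynomial.C (LaurentPolynomial.T k)

/-- The matrix `M₊`. -/
noncomputable def Mplus : Side → Side → Laurent₂
  | .l, .l => 1 - xPow 1
  | .l, .r => -yPow 1
  | .r, .l => -(xPow 1 * yPow (-1))
  | .r, .r => 0

/-- The matrix `M₋`. -/
noncomputable def Mminus : Side → Side → Laurent₂
  | .l, .l => 0
  | .l, .r => -(xPow (-1) * yPow 1)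
  | .r, .l => -yPow (-1)
  | .r, .r => 1 - xPow (-1)

open Classical in
/-- The block diagonal matrix `M` with one block `M₊` or `M₋` for each classical crossing. -/
noncomputable def M :
    Matrix (D.ClassicalCrossing × Side) (D.ClassicalCrossing × Side) Laurent₂ :=
  Matrix.of fun p q =>
    if p.1 = q.1 then
      if D.kind p.1.1 = .positive then Mplus p.2 q.2 else Mminus p.2 q.2
    else 0

open Classical in
/-- The permutation matrix `P` of the assignment `(i,a) ↦ (j,b)` if the half-edges `(i,a)⁺` and
`(j,b)⁻` belong to the same edge of the diagram's graph (virtual crossings being ignored). -/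
noncomputable def P :
    Matrix (D.ClassicalCrossing × Side) (D.ClassicalCrossing × Side) Laurent₂ :=
  Matrix.of fun p q => if D.Reaches (p.1.1, p.2) (q.1.1, q.2) then 1 else 0

/-- The writhe: the number of positive minus the number of negative crossings. -/
noncomputable def writhe : ℤ :=
  (Nat.card {v : D.V // D.kind v = .positive} : ℤ) -
    (Nat.card {v : D.V // D.kind v = .negative} : ℤ)

/-- The diagram has at least one classical crossing. -/
def HasClassicalCrossing : Prop := ∃ v : D.V, D.kind v ≠ .virtual

open Classical in
/-- The Conway polynomial `Z_D(x,y) = (-1)^{w(D)} det(M - P)` (zero when there is no classical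
crossing). -/
noncomputable def Z : Laurent₂ :=
  if D.HasClassicalCrossing then ((-1 : Laurent₂ˣ) ^ D.writhe : Laurent₂ˣ) * (D.M - D.P).det
  else 0

open Classical in
/-- The normalization of a Laurent polynomial in `x`: for `f ≠ 0` multiply by `x^{-N}`,
where `N` is the lowest exponent of `x` in `f`. -/
noncomputable def normalize (f : Laurent₂) : Laurent₂ :=
  if h : f.coeff.support.Nonempty then xPow (-(f.coeff.support.min' h)) * f else 0

/-- The normalized Conway polynomial. -/
noncomputable def Ztilde : Laurent₂ := normalize D.Z

end VirtualLinkDiagram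

end VirtualLink

/-! (a) The blocks $M_+$ and $M_-$ are inverse to each other, so they share the eigenvector
$(1,-xy^{-1})$ for the eigenvalue 1. A plane diagram has an Alexander numbering: integers on the
edges, equal on the two left edges of each crossing, equal on the two right edges, and larger by one
on the right (`exists_alexander_numbering`). Raising $-xy^{-1}$ to these numbers gives a vector
fixed by $M$ (`M_mulVec`). If there are no virtual crossings, $P$ only follows `next`, which
preserves the numbering, so $P$ fixes the vector too (`P_mulVec`). Hence $M-P$ kills a vector whose
entries are units, and its determinant vanishes. The numbering is where planarity enters. Every
vertex has two edges in and two out, so the constant 1 is a flow on the edges. Euler's formula makes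
every flow a difference of face values, and the numbering is read off the faces. (b) Both $M$ and
$P$ become block diagonal, the writhe is additive, and lowest exponents of $x$ add because $\mathbb
Z[y^{\pm1}]$ is a domain (`normalize_mul`). -/

namespace VirtualLink

/-! ### Alexander numberings from planarity -/

section Numbering

variable {V : Type} (next : Equiv.Perm (V × Side))

instance [Finite V] : Finite (Face next) := inferInstanceAs (Finite (Quot _))

instance [Finite V] : Finite (Component next) := inferInstanceAs (Finite (Quot _))

/-- The face on one side of a half-edge: the right-hand side of the edge for an outgoing
half-edge, and the left-hand side for an incoming one. -/
def faceOf (d : HalfEdge V) : Face next := Quot.mk _ d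

theorem faceOf_rotate (d : HalfEdge V) :
    faceOf next d.rotate = faceOf next (d.opposite next) := by
  have h : (d.opposite next).opposite next = d := by
    cases d <;> simp [HalfEdge.opposite]
  have := Quot.sound (r := fun d e : HalfEdge V => (HalfEdge.opposite next d).rotate = e)
    (a := d.opposite next) (b := d.rotate) (by rw [h])
  exact this.symm

/-- This and the next three lemmas treat the left, bottom, right and top corners of a vertex: the
two half-edges bounding a corner border the same face. -/
theorem faceOf_out_symm_left (v : V) :
    faceOf next (.out (next.symm (v, .l))) = faceOf next (.out (v, .l)) :=
  (faceOf_rotate next (.into (v, .l))).symm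

theorem faceOf_out_right (v : V) :
    faceOf next (.out (v, .r)) = faceOf next (.into (next (v, .l))) :=
  faceOf_rotate next (.out (v, .l))

theorem faceOf_into_right (v : V) :
    faceOf next (.into (v, .r)) = faceOf next (.into (next (v, .r))) :=
  faceOf_rotate next (.out (v, .r))

theorem faceOf_into_left (v : V) :
    faceOf next (.into (v, .l)) = faceOf next (.out (next.symm (v, .r))) :=
  faceOf_rotate next (.into (v, .r))

/-- The difference of the values of a function of the faces at the two sides of each edge. -/
def faceDiff : (Face next → ℚ) →ₗ[ℚ] (V × Side → ℚ) where
  toFun f p := f (faceOf next (.into (next p))) - f (faceOf next (.out p))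
  map_add' f g := by ext p; simp only [Pi.add_apply]; ring
  map_smul' c f := by
    ext p; simp only [Pi.smul_apply, smul_eq_mul, RingHom.id_apply]; ring

/-- The net flow out of each vertex. -/
def vertexFlow : (V × Side → ℚ) →ₗ[ℚ] (V → ℚ) where
  toFun g v := g (v, .l) + g (v, .r) - g (next.symm (v, .l)) - g (next.symm (v, .r))
  map_add' f g := by ext p; simp only [Pi.add_apply]; ring
  map_smul' c f := by
    ext p; simp only [Pi.smul_apply, smul_eq_mul, RingHom.id_apply]; ring

/-- Around a vertex, each of the four corner values occurs twice, with opposite signs. -/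
theorem vertexFlow_faceDiff (f : Face next → ℚ) : vertexFlow next (faceDiff next f) = 0 := by
  ext v
  simp only [vertexFlow, faceDiff, LinearMap.coe_mk, AddHom.coe_mk, Equiv.apply_symm_apply,
    faceOf_out_symm_left, faceOf_out_right, faceOf_into_right, faceOf_into_left, Pi.zero_apply]
  ring

theorem vertexFlow_one : vertexFlow next (fun _ => 1) = 0 := by
  ext v
  simp [vertexFlow]

theorem range_faceDiff_le : LinearMap.range (faceDiff next) ≤ LinearMap.ker (vertexFlow next) := by
  rintro _ ⟨f, rfl⟩
  exact vertexFlow_faceDiff next f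

/-- A face function that does not jump across any edge is constant around each vertex, so it is
determined by one value per vertex. -/
theorem eq_out_left_of_faceDiff_eq_zero {f : Face next → ℚ} (hf : faceDiff next f = 0) (v : V)
    (a : Side) :
    f (faceOf next (.out (v, a))) = f (faceOf next (.out (v, .l))) ∧
      f (faceOf next (.into (v, a))) = f (faceOf next (.out (v, .l))) := by
  have h : ∀ p, f (faceOf next (.into (next p))) = f (faceOf next (.out p)) := fun p =>
    sub_eq_zero.mp (congrFun hf p)
  have h1 : f (faceOf next (.into (v, .l))) = f (faceOf next (.out (v, .l))) := by
    rw [← faceOf_out_symm_left, ← h, Equiv.apply_symm_apply]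
  have h2 : f (faceOf next (.out (v, .r))) = f (faceOf next (.out (v, .l))) := by
    rw [faceOf_out_right, h]
  cases a
  · exact ⟨rfl, h1⟩
  · exact ⟨h2, by rw [faceOf_into_right, h, h2]⟩

theorem vertexFlow_single [DecidableEq V] (p : V × Side) :
    vertexFlow next (Pi.single p 1) = Pi.single p.1 1 - Pi.single (next p).1 1 := by
  ext v
  obtain ⟨v₀, a⟩ := p
  have h : ∀ b, next.symm (v, b) = (v₀, a) ↔ (v, b) = next (v₀, a) :=
    fun b => Equiv.symm_apply_eq next
  generalize next (v₀, a) = q at h ⊢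
  obtain ⟨w, b⟩ := q
  simp only [vertexFlow, LinearMap.coe_mk, AddHom.coe_mk, Pi.single_apply, Pi.sub_apply, h,
    Prod.mk.injEq]
  cases a <;> cases b <;> simp

variable [Fintype V]

/-- The value around a vertex is the same at both ends of an edge, so an element of the kernel is
determined by one value per component. -/
theorem finrank_ker_faceDiff_le :
    Module.finrank ℚ (LinearMap.ker (faceDiff next)) ≤ Nat.card (Component next) := by
  have := Fintype.ofFinite (Component next)
  let φ : LinearMap.ker (faceDiff next) →ₗ[ℚ] (Component next → ℚ) :=
    { toFun := fun f => Quot.lift (fun v => f.1 (faceOf next (.out (v, .l)))) (by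
        rintro v w ⟨a, b, h⟩
        have h1 := sub_eq_zero.mp (congrFun (LinearMap.mem_ker.mp f.2) (v, a))
        have h2 := (eq_out_left_of_faceDiff_eq_zero next f.2 v a).1
        have h3 := (eq_out_left_of_faceDiff_eq_zero next f.2 w b).2
        rw [h] at h1
        rw [← h2, ← h1, h3])
      map_add' := fun f g => by ext ⟨v⟩; rfl
      map_smul' := fun c f => by ext ⟨v⟩; rfl }
  have hφ : Function.Injective φ := by
    intro f g hfg
    ext ⟨d⟩
    have key : ∀ v, f.1 (faceOf next (.out (v, .l))) = g.1 (faceOf next (.out (v, .l))) :=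
      fun v => congrFun hfg (Quot.mk _ v)
    show f.1 (faceOf next d) = g.1 (faceOf next d)
    rcases d with ⟨v, a⟩ | ⟨v, a⟩
    · rw [(eq_out_left_of_faceDiff_eq_zero next f.2 v a).2,
        (eq_out_left_of_faceDiff_eq_zero next g.2 v a).2, key]
    · rw [(eq_out_left_of_faceDiff_eq_zero next f.2 v a).1,
        (eq_out_left_of_faceDiff_eq_zero next g.2 v a).1, key]
  have := LinearMap.finrank_le_finrank_of_injective hφ
  rwa [Module.finrank_fintype_fun_eq_card, ← Nat.card_eq_fintype_card] at this

/-- A functional vanishing on the net flows of single edges agrees on the basis vectors of adjacent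
vertices, so it too is determined by one value per component. This bounds the corank of
`vertexFlow`. -/
theorem finrank_dualAnnihilator_range_vertexFlow_le :
    Module.finrank ℚ (LinearMap.range (vertexFlow next)).dualAnnihilator ≤
      Nat.card (Component next) := by
  classical
  have := Fintype.ofFinite (Component next)
  let φ : (LinearMap.range (vertexFlow next)).dualAnnihilator →ₗ[ℚ] (Component next → ℚ) :=
    { toFun := fun f => Quot.lift (fun v => f.1 (Pi.single v 1)) (by
        rintro v w ⟨a, b, h⟩
        have h1 := (Submodule.mem_dualAnnihilator f.1).mp f.2 _ ⟨Pi.single (v, a) 1, rfl⟩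
        rw [vertexFlow_single, h, map_sub] at h1
        exact sub_eq_zero.mp h1)
      map_add' := fun f g => by ext ⟨v⟩; rfl
      map_smul' := fun c f => by ext ⟨v⟩; rfl }
  have hφ : Function.Injective φ := by
    intro f g hfg
    refine Subtype.ext (LinearMap.pi_ext' fun v => LinearMap.ext_ring ?_)
    exact congrFun hfg (Quot.mk _ v)
  have := LinearMap.finrank_le_finrank_of_injective hφ
  rwa [Module.finrank_fintype_fun_eq_card, ← Nat.card_eq_fintype_card] at this

/-- With $V$ vertices, $2V$ edges, $F$ faces and $k$ components, the range has dimension at least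
$F-k$ and the kernel at most $2V-(V-k)=V+k$. Planarity says $F-k=V+k$, which turns the inclusion
into equality. -/
theorem range_faceDiff_eq
    (planar : Nat.card (Face next) = Fintype.card V + 2 * Nat.card (Component next)) :
    LinearMap.range (faceDiff next) = LinearMap.ker (vertexFlow next) := by
  have := Fintype.ofFinite (Face next)
  refine Submodule.eq_of_le_of_finrank_le (range_faceDiff_le next) ?_
  have h1 := LinearMap.finrank_range_add_finrank_ker (faceDiff next)
  have h2 := LinearMap.finrank_range_add_finrank_ker (vertexFlow next)
  have h3 := Subspace.finrank_add_finrank_dualAnnihilator_eq (LinearMap.range (vertexFlow next))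
  have h4 := finrank_ker_faceDiff_le next
  have h5 := finrank_dualAnnihilator_range_vertexFlow_le next
  rw [Module.finrank_fintype_fun_eq_card] at h1 h2 h3
  rw [Fintype.card_prod, show Fintype.card Side = 2 from rfl] at h2
  rw [Nat.card_eq_fintype_card] at planar
  omega

/-- An Alexander numbering of the edges of a plane diagram, where an edge is denoted by the incoming
half-edge that it ends with: at every vertex, the two edges on the left have the same number, and
so have the two edges on the right, whose number is larger by one. -/
theorem exists_alexander_numbering
    (planar : Nat.card (Face next) = Fintype.card V + 2 * Nat.card (Component next)) :
    ∃ num : V × Side → ℤ, (∀ p, num (next p) = num p) ∧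
      ∀ v, num (v, .r) = num (v, .l) + 1 := by
  obtain ⟨f, hf⟩ : (fun _ => 1 : V × Side → ℚ) ∈ LinearMap.range (faceDiff next) := by
    rw [range_faceDiff_eq next planar]
    exact vertexFlow_one next
  have h : ∀ p, f (faceOf next (.into (next p))) = f (faceOf next (.out p)) + 1 := fun p => by
    have := congrFun hf p
    simp only [faceDiff, LinearMap.coe_mk, AddHom.coe_mk] at this
    linarith
  have hr : ∀ v, f (faceOf next (.out (next.symm (v, .r)))) =
      f (faceOf next (.out (next.symm (v, .l)))) + 1 := fun v => by
    have := h (next.symm (v, .l))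
    rw [Equiv.apply_symm_apply] at this
    rw [← faceOf_into_left, this]
  -- An edge gets the value of the face on its right-hand side in the direction of travel. Only the
  -- jumps of `f` are known to be integers; the floor makes the values integral and keeps jumps of
  -- 1.
  refine ⟨fun p => ⌊f (faceOf next (.out (next.symm p)))⌋, ?_, ?_⟩
  · rintro ⟨v, _ | _⟩ <;> simp only [Equiv.symm_apply_apply]
    · rw [faceOf_out_symm_left]
    · rw [faceOf_out_right, h, hr, faceOf_out_symm_left]
  · intro v
    simp only
    rw [hr, Int.floor_add_one]

end Numbering
namespace VirtualLinkDiagram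

/-! ### Normalization -/

theorem normalize_zero : normalize 0 = 0 := by
  simp [normalize]

/-- The normalization in terms of the lowest exponent. -/
theorem normalize_eq_of_isLeast (f : Laurent₂) (n : ℤ) (hn : f.coeff n ≠ 0)
    (hmin : ∀ m, f.coeff m ≠ 0 → n ≤ m) : normalize f = xPow (-n) * f := by
  have hne : f.coeff.support.Nonempty := ⟨n, Finsupp.mem_support_iff.mpr hn⟩
  have hm : f.coeff.support.min' hne = n :=
    le_antisymm (Finset.min'_le _ _ (Finsupp.mem_support_iff.mpr hn))
      (Finset.le_min' _ _ _ fun m hm => hmin m (Finsupp.mem_support_iff.mp hm))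
  rw [normalize, dif_pos hne, hm]

theorem exists_lowest_exponent (f : Laurent₂) (hf : f ≠ 0) :
    ∃ n, f.coeff n ≠ 0 ∧ ∀ m, f.coeff m ≠ 0 → n ≤ m := by
  have hne : f.coeff.support.Nonempty := by
    rw [Finset.nonempty_iff_ne_empty]
    intro h
    rw [Finsupp.support_eq_empty] at h
    exact hf (LaurentPolynomial.ext fun a => by rw [h]; rfl)
  exact ⟨f.coeff.support.min' hne, Finsupp.mem_support_iff.mp (Finset.min'_mem _ hne),
    fun m hm => Finset.min'_le _ _ (Finsupp.mem_support_iff.mpr hm)⟩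

theorem normalize_mul (f g : Laurent₂) : normalize (f * g) = normalize f * normalize g := by
  classical
  by_cases hf : f = 0
  · simp [hf, normalize_zero]
  by_cases hg : g = 0
  · simp [hg, normalize_zero]
  obtain ⟨m, hm, hm'⟩ := exists_lowest_exponent f hf
  obtain ⟨n, hn, hn'⟩ := exists_lowest_exponent g hg
  -- The lowest exponents can add up to `m + n` in one way only, so that coefficient of the product
  -- is the product of the two lowest coefficients.
  have hu : UniqueAdd f.coeff.support g.coeff.support m n := by
    intro a b ha hb hab
    have h1 := hm' a (Finsupp.mem_support_iff.mp ha)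
    have h2 := hn' b (Finsupp.mem_support_iff.mp hb)
    omega
  have hmn : (f * g).coeff (m + n) ≠ 0 := by
    rw [AddMonoidAlgebra.coeff_mul_add_of_uniqueAdd hu]
    exact mul_ne_zero hm hn
  have hmin : ∀ k, (f * g).coeff k ≠ 0 → m + n ≤ k := by
    intro k hk
    obtain ⟨a, ha, b, hb, rfl⟩ := Finset.mem_add.mp
      (AddMonoidAlgebra.support_coeff_mul_subset f g (Finsupp.mem_support_iff.mpr hk))
    exact add_le_add (hm' a (Finsupp.mem_support_iff.mp ha))
      (hn' b (Finsupp.mem_support_iff.mp hb))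
  rw [normalize_eq_of_isLeast _ _ hmn hmin, normalize_eq_of_isLeast _ _ hm hm',
    normalize_eq_of_isLeast _ _ hn hn', neg_add, xPow, LaurentPolynomial.T_add]
  simp only [xPow]
  ring

/-! ### Classical diagrams -/

theorem sum_side {A : Type*} [AddCommMonoid A] (f : Side → A) : ∑ a, f a = f .l + f .r := by
  rw [show (Finset.univ : Finset Side) = {.l, .r} from rfl, Finset.sum_pair (by decide)]

theorem xPow_mul_xPow (m n : ℤ) : xPow m * xPow n = xPow (m + n) :=
  (LaurentPolynomial.T_add m n).symm

theorem yPow_mul_yPow (m n : ℤ) : yPow m * yPow n = yPow (m + n) := by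
  rw [yPow, yPow, yPow, LaurentPolynomial.T_add, map_mul]

theorem xPow_zero : xPow 0 = 1 := LaurentPolynomial.T_zero

theorem yPow_zero : yPow 0 = 1 := by rw [yPow, LaurentPolynomial.T_zero, map_one]

theorem xPow_one_mul_neg_one : xPow 1 * xPow (-1) = 1 := by
  rw [xPow_mul_xPow, add_neg_cancel, xPow_zero]

theorem yPow_one_mul_neg_one : yPow 1 * yPow (-1) = 1 := by
  rw [yPow_mul_yPow, add_neg_cancel, yPow_zero]

/-- The unit `-x y⁻¹`, the ratio of the two entries of an eigenvector of `M₊` and `M₋` for the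
eigenvalue `1`. -/
noncomputable def eigenratio : Laurent₂ˣ where
  val := -(xPow 1 * yPow (-1))
  inv := -(xPow (-1) * yPow 1)
  val_inv := by linear_combination yPow 1 * yPow (-1) * xPow_one_mul_neg_one + yPow_one_mul_neg_one
  inv_val := by linear_combination yPow 1 * yPow (-1) * xPow_one_mul_neg_one + yPow_one_mul_neg_one

theorem Mplus_eigenvector (a : Side) (c : Side → Laurent₂) (hc : c .r = eigenratio * c .l) :
    Mplus a .l * c .l + Mplus a .r * c .r = c a := by
  cases a <;> simp only [Mplus, hc, eigenratio]
  · linear_combination c .l * xPow 1 * yPow_one_mul_neg_one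
  · ring

theorem Mminus_eigenvector (a : Side) (c : Side → Laurent₂) (hc : c .r = eigenratio * c .l) :
    Mminus a .l * c .l + Mminus a .r * c .r = c a := by
  cases a <;> simp only [Mminus, hc, eigenratio]
  · linear_combination c .l * yPow 1 * yPow (-1) * xPow_one_mul_neg_one +
      c .l * yPow_one_mul_neg_one
  · linear_combination c .l * yPow (-1) * xPow_one_mul_neg_one

theorem reaches_iff_of_isClassical {D : VirtualLinkDiagram} (hD : D.IsClassical)
    (p q : D.V × Side) : D.Reaches p q ↔ q = D.next p := by
  constructor
  · intro h
    cases h with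
    | edge => rfl
    | pass v a _ hv => exact absurd hv (hD v)
  · rintro rfl
    exact .edge

theorem M_mulVec (D : VirtualLinkDiagram) (c : D.V × Side → Laurent₂)
    (hc : ∀ v, c (v, .r) = eigenratio * c (v, .l)) :
    D.M.mulVec (fun q => c (q.1.1, q.2)) = fun q => c (q.1.1, q.2) := by
  ext1 ⟨v, a⟩
  simp only [Matrix.mulVec, dotProduct, M, Matrix.of_apply, Fintype.sum_prod_type, ite_mul,
    zero_mul]
  rw [Finset.sum_comm]
  simp only [Finset.sum_ite_eq, Finset.mem_univ, if_true, sum_side]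
  split_ifs
  · exact Mplus_eigenvector a (fun b => c (v.1, b)) (hc v.1)
  · exact Mminus_eigenvector a (fun b => c (v.1, b)) (hc v.1)

/-- Without virtual crossings each row of $P$ has its single 1 at the half-edge given by `next`. -/
theorem P_mulVec {D : VirtualLinkDiagram} (hD : D.IsClassical) (c : D.V × Side → Laurent₂) :
    D.P.mulVec (fun q => c (q.1.1, q.2)) = fun q => c (D.next (q.1.1, q.2)) := by
  ext1 p
  obtain ⟨q, hq⟩ : ∃ q : D.ClassicalCrossing × Side, (q.1.1, q.2) = D.next (p.1.1, p.2) :=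
    ⟨(⟨(D.next (p.1.1, p.2)).1, hD _⟩, (D.next (p.1.1, p.2)).2), rfl⟩
  simp only [Matrix.mulVec, dotProduct, P, Matrix.of_apply]
  rw [Finset.sum_eq_single q, if_pos ((reaches_iff_of_isClassical hD _ _).mpr hq), one_mul, hq]
  · intro q' _ hne
    rw [if_neg, zero_mul]
    rw [reaches_iff_of_isClassical hD, ← hq, Prod.mk.injEq]
    exact fun h => hne (Prod.ext (Subtype.ext h.1) h.2)
  · simp

theorem det_eq_zero_of_isClassical {D : VirtualLinkDiagram} (hD : D.IsClassical)
    (h : D.HasClassicalCrossing) : (D.M - D.P).det = 0 := by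
  obtain ⟨num, hnext, hside⟩ := exists_alexander_numbering D.next D.planar
  obtain ⟨v, hv⟩ := h
  let c : D.V × Side → Laurent₂ := fun p => (eigenratio ^ num p : Laurent₂ˣ)
  have hker : (D.M - D.P).mulVec (fun q => c (q.1.1, q.2)) = 0 := by
    rw [Matrix.sub_mulVec, P_mulVec hD, M_mulVec, sub_eq_zero]
    · simp only [c, hnext]
    · intro v
      simp only [c, hside, zpow_add_one, Units.val_mul]
      ring
  -- The adjugate shows that the determinant annihilates every kernel vector; since one entry is a
  -- unit, the determinant itself is zero.
  have hdet : (D.M - D.P).det • (fun q : D.ClassicalCrossing × Side => c (q.1.1, q.2)) = 0 := by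
    rw [← Matrix.one_mulVec (fun q : D.ClassicalCrossing × Side => c (q.1.1, q.2)),
      ← Matrix.smul_mulVec, ← Matrix.adjugate_mul, ← Matrix.mulVec_mulVec, hker,
      Matrix.mulVec_zero]
  exact (Units.mul_left_eq_zero _).mp (congrFun hdet (⟨v, hv⟩, .l))

theorem Z_eq_zero_of_isClassical {D : VirtualLinkDiagram} (hD : D.IsClassical) : D.Z = 0 := by
  unfold Z
  split_ifs with h
  · rw [det_eq_zero_of_isClassical hD h, mul_zero]
  · rfl

/-! ### Disconnected sums -/

variable (D₁ D₂ : VirtualLinkDiagram)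

/-- The rows of the matrices of a disconnected sum. -/
def sumIndexEquiv : (D₁.ClassicalCrossing × Side) ⊕ (D₂.ClassicalCrossing × Side) ≃
    (D₁.disjointSum D₂).ClassicalCrossing × Side where
  toFun := Sum.elim (fun p => (⟨Sum.inl p.1.1, p.1.2⟩, p.2))
    (fun p => (⟨Sum.inr p.1.1, p.1.2⟩, p.2))
  invFun
    | (⟨Sum.inl v, h⟩, a) => Sum.inl (⟨v, h⟩, a)
    | (⟨Sum.inr v, h⟩, a) => Sum.inr (⟨v, h⟩, a)
  left_inv := by rintro (p | p) <;> rfl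
  right_inv := by rintro ⟨⟨v | v, h⟩, a⟩ <;> rfl

/-- A path never leaves its summand. The endpoint `q` is left arbitrary so that induction along the
path applies. -/
theorem reaches_disjointSum_inl (v : D₁.V) (a : Side) (q : (D₁.disjointSum D₂).V × Side) :
    (D₁.disjointSum D₂).Reaches (Sum.inl v, a) q ↔
      ∃ q' : D₁.V × Side, q = (Sum.inl q'.1, q'.2) ∧ D₁.Reaches (v, a) q' := by
  constructor
  · intro h
    induction h with
    | edge => exact ⟨_, rfl, .edge⟩
    | pass w b _ hw ih =>
      obtain ⟨⟨w', b'⟩, h, hr⟩ := ih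
      obtain ⟨rfl, rfl⟩ := Prod.mk.inj h
      exact ⟨_, rfl, .pass w' b hr hw⟩
  · rintro ⟨q', rfl, h⟩
    induction h with
    | edge => exact .edge
    | pass w b _ hw ih => exact .pass (D := D₁.disjointSum D₂) (Sum.inl w) b ih hw

theorem reaches_disjointSum_inr (v : D₂.V) (a : Side) (q : (D₁.disjointSum D₂).V × Side) :
    (D₁.disjointSum D₂).Reaches (Sum.inr v, a) q ↔
      ∃ q' : D₂.V × Side, q = (Sum.inr q'.1, q'.2) ∧ D₂.Reaches (v, a) q' := by
  constructor
  · intro h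
    induction h with
    | edge => exact ⟨_, rfl, .edge⟩
    | pass w b _ hw ih =>
      obtain ⟨⟨w', b'⟩, h, hr⟩ := ih
      obtain ⟨rfl, rfl⟩ := Prod.mk.inj h
      exact ⟨_, rfl, .pass w' b hr hw⟩
  · rintro ⟨q', rfl, h⟩
    induction h with
    | edge => exact .edge
    | pass w b _ hw ih => exact .pass (D := D₁.disjointSum D₂) (Sum.inr w) b ih hw

theorem M_disjointSum : (D₁.disjointSum D₂).M.submatrix (sumIndexEquiv D₁ D₂)
    (sumIndexEquiv D₁ D₂) = Matrix.fromBlocks D₁.M 0 0 D₂.M := by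
  ext1 (p | p) (q | q)
  · have h : ((sumIndexEquiv D₁ D₂ (Sum.inl p)).1 = (sumIndexEquiv D₁ D₂ (Sum.inl q)).1) ↔
        p.1 = q.1 :=
      ⟨fun h => Subtype.ext (Sum.inl_injective (congrArg Subtype.val h)),
        congrArg fun v : D₁.ClassicalCrossing =>
          (⟨Sum.inl v.1, v.2⟩ : (D₁.disjointSum D₂).ClassicalCrossing)⟩
    simp only [Matrix.submatrix_apply, M, Matrix.of_apply, h, Matrix.fromBlocks_apply₁₁]
    rfl
  · exact if_neg fun h => Sum.inl_ne_inr (congrArg Subtype.val h)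
  · exact if_neg fun h => Sum.inr_ne_inl (congrArg Subtype.val h)
  · have h : ((sumIndexEquiv D₁ D₂ (Sum.inr p)).1 = (sumIndexEquiv D₁ D₂ (Sum.inr q)).1) ↔
        p.1 = q.1 :=
      ⟨fun h => Subtype.ext (Sum.inr_injective (congrArg Subtype.val h)),
        congrArg fun v : D₂.ClassicalCrossing =>
          (⟨Sum.inr v.1, v.2⟩ : (D₁.disjointSum D₂).ClassicalCrossing)⟩
    simp only [Matrix.submatrix_apply, M, Matrix.of_apply, h, Matrix.fromBlocks_apply₂₂]
    rfl

theorem P_disjointSum : (D₁.disjointSum D₂).P.submatrix (sumIndexEquiv D₁ D₂)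
    (sumIndexEquiv D₁ D₂) = Matrix.fromBlocks D₁.P 0 0 D₂.P := by
  classical
  ext1 (⟨p, a⟩ | ⟨p, a⟩) (⟨q, b⟩ | ⟨q, b⟩)
  · refine if_congr ((reaches_disjointSum_inl D₁ D₂ p.1 a _).trans ⟨?_, fun h => ⟨_, rfl, h⟩⟩)
      rfl rfl
    rintro ⟨⟨w, c⟩, h, hr⟩
    obtain ⟨h1, rfl⟩ := Prod.mk.inj h
    obtain rfl := Sum.inl_injective h1
    exact hr
  · refine if_neg fun h => ?_
    obtain ⟨_, h, -⟩ := (reaches_disjointSum_inl D₁ D₂ p.1 a _).mp h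
    exact Sum.inr_ne_inl (congrArg Prod.fst h)
  · refine if_neg fun h => ?_
    obtain ⟨_, h, -⟩ := (reaches_disjointSum_inr D₁ D₂ p.1 a _).mp h
    exact Sum.inl_ne_inr (congrArg Prod.fst h)
  · refine if_congr ((reaches_disjointSum_inr D₁ D₂ p.1 a _).trans ⟨?_, fun h => ⟨_, rfl, h⟩⟩)
      rfl rfl
    rintro ⟨⟨w, c⟩, h, hr⟩
    obtain ⟨h1, rfl⟩ := Prod.mk.inj h
    obtain rfl := Sum.inr_injective h1
    exact hr

theorem det_disjointSum : ((D₁.disjointSum D₂).M - (D₁.disjointSum D₂).P).det =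
    (D₁.M - D₁.P).det * (D₂.M - D₂.P).det := by
  rw [← Matrix.det_submatrix_equiv_self (sumIndexEquiv D₁ D₂), Matrix.submatrix_sub,
    Pi.sub_apply, Pi.sub_apply, M_disjointSum, P_disjointSum, sub_eq_add_neg,
    Matrix.fromBlocks_neg, Matrix.fromBlocks_add, neg_zero, add_zero, neg_zero, add_zero,
    Matrix.det_fromBlocks_zero₂₁, sub_eq_add_neg, sub_eq_add_neg]

theorem card_kind_disjointSum (t : CrossingType) :
    Nat.card {v // (D₁.disjointSum D₂).kind v = t} =
      Nat.card {v // D₁.kind v = t} + Nat.card {v // D₂.kind v = t} := by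
  rw [← Nat.card_sum]
  exact Nat.card_congr Equiv.subtypeSum

theorem writhe_disjointSum : (D₁.disjointSum D₂).writhe = D₁.writhe + D₂.writhe := by
  simp only [writhe, card_kind_disjointSum, Nat.cast_add]
  ring

theorem hasClassicalCrossing_disjointSum : (D₁.disjointSum D₂).HasClassicalCrossing ↔
    D₁.HasClassicalCrossing ∨ D₂.HasClassicalCrossing :=
  Sum.exists

/-- The hypothesis excludes the mixed case, where one factor is 0 by convention although the
determinant of the sum is that of the other diagram. -/
theorem Z_disjointSum (h : D₁.HasClassicalCrossing ↔ D₂.HasClassicalCrossing) :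
    (D₁.disjointSum D₂).Z = D₁.Z * D₂.Z := by
  by_cases h₂ : D₂.HasClassicalCrossing
  · have h₁ := h.mpr h₂
    rw [Z, Z, Z, if_pos h₁, if_pos h₂,
      if_pos ((hasClassicalCrossing_disjointSum D₁ D₂).mpr (Or.inl h₁)), det_disjointSum,
      writhe_disjointSum, zpow_add, Units.val_mul]
    ring
  · have h₁ := mt h.mp h₂
    rw [Z, Z, Z, if_neg h₁, if_neg h₂,
      if_neg (mt (hasClassicalCrossing_disjointSum D₁ D₂).mp (not_or.mpr ⟨h₁, h₂⟩)), mul_zero]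

end VirtualLinkDiagram
end VirtualLink

theorem mainTheorem5 :
    (∀ D : VirtualLink.VirtualLinkDiagram, D.IsClassical → D.Z = 0 ∧ D.Ztilde = 0) ∧
    (∀ D₁ D₂ : VirtualLink.VirtualLinkDiagram,
      (D₁.HasClassicalCrossing ↔ D₂.HasClassicalCrossing) →
        (D₁.disjointSum D₂).Z = D₁.Z * D₂.Z ∧
        (D₁.disjointSum D₂).Ztilde = D₁.Ztilde * D₂.Ztilde) := by
  open VirtualLink.VirtualLinkDiagram in
  refine ⟨fun D hD => ?_, fun D₁ D₂ h => ?_⟩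
  · have hZ := Z_eq_zero_of_isClassical hD
    exact ⟨hZ, by rw [Ztilde, hZ, normalize_zero]⟩
  · have hZ := Z_disjointSum D₁ D₂ h
    exact ⟨hZ, by rw [Ztilde, hZ, normalize_mul, Ztilde, Ztilde]⟩
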